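/- Let $T$ be a tree on $n \ge 3$ vertices with $p$ leaves (vertices of degree $1$), and let $d_{x,y}$ denote the distance in $T$ between vertices $x$ and $y$. Let $\mathrm{Max4PC}_T$ be the $\binom n2 \times \binom n2$ integer matrix whose rows and columns are indexed by the unordered pairs of distinct vertices of $T$ and whose entry in row $\{w,x\}$ and column $\{y,z\}$ is $$\max\{\, d_{w,x}+d_{y,z},\ d_{w,y}+d_{x,z},\ d_{w,z}+d_{x,y} \,\}.$$ Then the invariant factors of $\mathrm{Max4PC}_T$ over $\mathbb Z$ (the diagonal entries of its Smith normal form, that is, of the diagonal matrix with nonnegative entries, each dividing the next, obtained from $\mathrm{Max4PC}_T$ by multiplying on the left and on the right by matrices invertible over $\mathbb Z$) are, in the order of divisibility, $$1,\ 1,\ \underbrace{2,\dots,2}_{2(n-p-1)},\ \underbrace{0,\dots,0}_{\binom n2-2(n-p)}.$$ -/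

import Mathlib

/-- The two-element subsets of `V`, as non-diagonal unordered pairs. -/
abbrev VertexPair (V : Type*) : Type _ := {e : Sym2 V // ¬ e.IsDiag}

/-- The maximum of the three sums `d(w,x) + d(y,z)`, `d(w,y) + d(x,z)`, `d(w,z) + d(x,y)`,
as a function of the unordered pairs `{w,x}` and `{y,z}`. -/
noncomputable def SimpleGraph.max4PCEntry {V : Type*} (T : SimpleGraph V) : Sym2 V → Sym2 V → ℕ :=
  Sym2.lift₂ ⟨fun w x y z =>
    max (T.dist w x + T.dist y z) (max (T.dist w y + T.dist x z) (T.dist w z + T.dist x y)), by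
      intro w x y z
      refine ⟨?_, ?_⟩
      · dsimp only
        rw [T.dist_comm (u := w) (v := x), max_comm (T.dist w y + T.dist x z),
          add_comm (T.dist w z), add_comm (T.dist w y)]
      · dsimp only
        rw [T.dist_comm (u := y) (v := z), max_comm (T.dist w y + T.dist x z)]⟩

/-- The maximum four point condition matrix, with integer entries; its rows and columns are
indexed by the pairs of distinct vertices. -/
noncomputable def SimpleGraph.max4PC {V : Type*} (T : SimpleGraph V) :
    Matrix (VertexPair V) (VertexPair V) ℤ :=
  Matrix.of fun e f => (T.max4PCEntry e.1 f.1 : ℤ)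

/-- `l` is the list of invariant factors over `ℤ` of the square matrix `M`, in the order of
divisibility (so zeros come last): `l` has one entry for each row of `M`, the entries are
nonnegative, each divides the next, and `M` is carried to the diagonal matrix with diagonal `l`
by multiplication on the left and on the right by matrices that are invertible over `ℤ`. -/
structure Matrix.HasInvariantFactors {ι : Type*} [Fintype ι] [DecidableEq ι]
    (M : Matrix ι ι ℤ) (l : List ℤ) : Prop where
  length_eq : l.length = Fintype.card ι
  nonneg : ∀ a ∈ l, 0 ≤ a
  chain : l.IsChain (· ∣ ·)
  exists_equiv : ∃ (P Q : GL ι ℤ) (e : ι ≃ Fin l.length),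
    (P : Matrix ι ι ℤ) * M * (Q : Matrix ι ι ℤ) = Matrix.diagonal fun i => l.get (e i)

/-! Fix a tree on at least three vertices. Each dart has a head side, the component of its head once
its edge is deleted, and a distance is the number of darts with exactly the end vertex on the head
side. As the sides of two edges do not cross, at most one of the three separation numbers of a
quadruple is nonzero, and comparing the three sums of distances shows that the entry of the matrix
at pairs `e`, `f` is `d(e) + d(f) + 2 s(e, f)`, where `s(e, f)` counts the edges separating `e` from
`f`. Leaf edges separate no two pairs, so `s` is a sum of products over the `2 (n - p - 1)` inner
darts, and the matrix becomes `U * diag(1, 1, 2, …, 2) * Vᵀ` with `V` a column permutation of `U`.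

The rows of `U` generate the whole lattice: for a path `x, y, z` the difference of the rows `{x, z}`
and `{x, y}` is the unit vector of the distance column minus that of the dart `(z, y)`, and the
latter is absent when `z` is a leaf. Hence `U` and `V` extend to unimodular matrices. -/

namespace TreeFourPoint

open Finset SimpleGraph
open scoped Matrix

section UnimodularCompletion

open Module

variable {R ι κ μ : Type*} [CommRing R] [IsDomain R] [IsPrincipalIdealRing R]

theorem exists_basis_inl_eq_of_comp_eq_id [Finite κ] [Finite μ] {M N : Type*} [AddCommGroup M]
    [Module R M] [AddCommGroup N] [Module R N] {f : M →ₗ[R] N} {g : N →ₗ[R] M}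
    (hgf : g ∘ₗ f = LinearMap.id) (b : Basis κ R M) (c : Basis (κ ⊕ μ) R N) :
    ∃ b' : Basis (κ ⊕ μ) R N, ∀ k, b' (Sum.inl k) = f (b k) := by
  have := Fintype.ofFinite κ
  have := Fintype.ofFinite μ
  have := Module.Free.of_basis c
  have := Module.Finite.of_basis c
  have := Module.Free.of_basis b
  have := Module.Finite.of_basis b
  have hgf' : ∀ x, g (f x) = x := LinearMap.congr_fun hgf
  have hbij : Function.Bijective (f.coprod (LinearMap.ker g).subtype) := by
    refine ⟨(injective_iff_map_eq_zero _).2 fun ⟨x, y, hy⟩ hxy => ?_, fun z =>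
      ⟨(g z, ⟨z - f (g z), by simp [hgf']⟩), by simp⟩⟩
    replace hxy : f x + y = 0 := hxy
    have hx : x = 0 := by simpa [hgf', LinearMap.mem_ker.1 hy] using congrArg g hxy
    simpa [hx] using hxy
  let φ := LinearEquiv.ofBijective _ hbij
  have hrank : finrank R (LinearMap.ker g) = Fintype.card μ := by
    have h := φ.finrank_eq
    rw [finrank_prod, finrank_eq_card_basis b, finrank_eq_card_basis c, Fintype.card_sum] at h
    exact Nat.add_left_cancel h
  let d := (finBasisOfFinrankEq R _ hrank).reindex (Fintype.equivFin μ).symm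
  exact ⟨(b.prod d).map φ, fun k => by simp [φ]⟩

variable [Fintype ι] [DecidableEq ι] [Finite μ]

theorem exists_isUnit_mul_eq_fromRows [Finite κ] [DecidableEq κ] {U : Matrix ι κ R}
    (hU : Function.Surjective U.vecMul) (e : ι ≃ κ ⊕ μ) :
    ∃ P : Matrix ι ι R, IsUnit P ∧
      P * U = (Matrix.fromRows (1 : Matrix κ κ R) (0 : Matrix μ κ R)).submatrix e id := by
  have := Fintype.ofFinite κ
  obtain ⟨W, hWU⟩ := Matrix.vecMul_surjective_iff_exists_left_inverse.1 hU
  have hcomp : W.mulVecLin ∘ₗ U.mulVecLin = LinearMap.id := by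
    rw [← Matrix.mulVecLin_mul, hWU, Matrix.mulVecLin_one]
  obtain ⟨b, hb⟩ := exists_basis_inl_eq_of_comp_eq_id hcomp (Pi.basisFun R κ)
    ((Pi.basisFun R ι).reindex e)
  have hUb : U = (Pi.basisFun R ι).toMatrix (b ∘ Sum.inl) := by
    ext i k
    simp [Basis.toMatrix_apply, hb]
  have := (b.reindex e.symm).invertibleToMatrix (Pi.basisFun R ι)
  refine ⟨(b.reindex e.symm).toMatrix (Pi.basisFun R ι), isUnit_of_invertible _, ?_⟩
  rw [hUb, Basis.toMatrix_mul_toMatrix]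
  ext i k
  rcases hi : e i with k' | m <;>
    simp [Basis.toMatrix_apply, hi, Finsupp.single_apply, Matrix.one_apply,
      Equiv.eq_symm_apply, eq_comm]

theorem exists_GL_mul_mul_eq_diagonal [Fintype κ] [DecidableEq κ]
    {U V : Matrix ι κ R} (hU : Function.Surjective U.vecMul) (hV : Function.Surjective V.vecMul)
    (D : κ → R) (e : ι ≃ κ ⊕ μ) :
    ∃ P Q : GL ι R, (P : Matrix ι ι R) * (U * Matrix.diagonal D * Vᵀ) * (Q : Matrix ι ι R) =
      Matrix.diagonal (Sum.elim D (fun _ => 0) ∘ e) := by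
  classical
  obtain ⟨_, ⟨P, rfl⟩, hP⟩ := exists_isUnit_mul_eq_fromRows hU e
  obtain ⟨Q, hQ_unit, hQ⟩ := exists_isUnit_mul_eq_fromRows hV e
  obtain ⟨Q', hQ'⟩ := (Matrix.isUnit_transpose Q).2 hQ_unit
  refine ⟨P, Q', ?_⟩
  let B : Matrix (κ ⊕ μ) κ R := Matrix.fromRows 1 0
  calc (P : Matrix ι ι R) * (U * Matrix.diagonal D * Vᵀ) * (Q' : Matrix ι ι R)
      = (P.1 * U) * Matrix.diagonal D * (Q * V)ᵀ := by
        rw [hQ', Matrix.transpose_mul]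
        simp only [Matrix.mul_assoc]
    _ = (B * Matrix.diagonal D * Bᵀ).submatrix e e := by
        rw [hP, hQ, Matrix.submatrix_mul _ _ _ id _ Function.bijective_id,
          Matrix.submatrix_mul _ _ _ id _ Function.bijective_id, Matrix.submatrix_id_id,
          Matrix.transpose_submatrix]
    _ = (Matrix.fromBlocks (Matrix.diagonal D) 0 0 0).submatrix e e := by
        dsimp only [B]
        rw [Matrix.transpose_fromRows, Matrix.fromRows_mul, Matrix.fromRows_mul_fromCols]
        simp only [Matrix.transpose_one, Matrix.transpose_zero, Matrix.one_mul, Matrix.mul_one,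
          Matrix.zero_mul, Matrix.mul_zero]
    _ = Matrix.diagonal (Sum.elim D (fun _ => 0) ∘ e) := by
        rw [← Matrix.submatrix_diagonal_equiv, ← Matrix.fromBlocks_diagonal, Matrix.diagonal_zero]

end UnimodularCompletion

section InvariantFactors

theorem vecMul_submatrix_surjective {α ι κ κ' : Type*} [NonUnitalNonAssocSemiring α] [Fintype ι]
    {U : Matrix ι κ α} (hU : Function.Surjective U.vecMul) (σ : κ' ≃ κ) :
    Function.Surjective (U.submatrix id σ).vecMul := fun y =>
  (hU (y ∘ σ.symm)).imp fun _ hx => funext fun k =>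
    (congrFun hx (σ k)).trans (congrArg y (σ.symm_apply_apply k))

theorem exists_equiv_get_replicate_append {α β R : Type*} [Fintype α] [Fintype β] {a b : ℕ}
    (ha : Fintype.card α = a) (hb : Fintype.card β = b) (x y : R) :
    ∃ e : α ⊕ β ≃ Fin (List.replicate a x ++ List.replicate b y).length,
      ∀ i, (List.replicate a x ++ List.replicate b y).get (e i) =
        Sum.elim (fun _ => x) (fun _ => y) i := by
  refine ⟨((Fintype.equivFinOfCardEq ha).sumCongr (Fintype.equivFinOfCardEq hb)).trans
    (finSumFinEquiv.trans (finCongr (by simp))), ?_⟩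
  rintro (i | i) <;> simp

variable {ι κ : Type*} [Fintype ι] [DecidableEq ι] [Fintype κ] [DecidableEq κ]

theorem hasInvariantFactors_mul_diagonal_mul {U V : Matrix ι κ ℤ}
    (hU : Function.Surjective U.vecMul) (hV : Function.Surjective V.vecMul) {l : List ℤ}
    (hl_nonneg : ∀ a ∈ l, 0 ≤ a) (hl_chain : l.IsChain (· ∣ ·)) (e : κ ≃ Fin l.length) :
    (U * Matrix.diagonal (l.get ∘ e) * Vᵀ).HasInvariantFactors
      (l ++ List.replicate (Fintype.card ι - Fintype.card κ) 0) := by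
  have hcard : Fintype.card κ ≤ Fintype.card ι :=
    card_le_of_surjective ℤ U.vecMulLinear hU
  have hκ : l.length = Fintype.card κ := by rw [← Fintype.card_fin l.length, Fintype.card_congr e]
  set r := Fintype.card ι - Fintype.card κ
  have hlen : (l ++ List.replicate r 0).length = Fintype.card ι := by
    rw [List.length_append, List.length_replicate, hκ, Nat.add_sub_cancel' hcard]
  obtain ⟨g⟩ : Nonempty (ι ≃ κ ⊕ Fin r) := Fintype.card_eq.1 <| by
    rw [Fintype.card_sum, Fintype.card_fin, Nat.add_sub_cancel' hcard]
  obtain ⟨P, Q, hPQ⟩ := exists_GL_mul_mul_eq_diagonal hU hV (l.get ∘ e) g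
  refine ⟨hlen, fun a ha => ?_, ?_, P, Q, g.trans ((e.sumCongr (Equiv.refl _)).trans
    (finSumFinEquiv.trans (finCongr (by simp)))), ?_⟩
  · rcases List.mem_append.1 ha with ha | ha
    · exact hl_nonneg a ha
    · exact (List.eq_of_mem_replicate ha).ge
  · refine hl_chain.append (List.isChain_replicate_of_rel _ dvd_rfl) fun a _ b hb => ?_
    rw [List.eq_of_mem_replicate (List.mem_of_mem_head? hb)]
    exact dvd_zero a
  · rw [hPQ]
    congr 1
    ext i
    rcases h : g i with k | m <;> simp [h]

end InvariantFactors

section Sides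

variable {V : Type*} {T : SimpleGraph V}

/-- The vertices on the head side of a dart `a`: those reachable from the head of `a` once its
underlying edge is deleted. In a tree, `headSide a` and `headSide a.symm` are the two components
left by this deletion. -/
def headSide (a : T.Dart) : Set V :=
  {v | (T.deleteEdges {a.edge}).Reachable a.snd v}

theorem snd_mem_headSide (a : T.Dart) : a.snd ∈ headSide a := Reachable.refl _

theorem mem_headSide_iff_of_edge_notMem {a : T.Dart} {v w : V} (p : T.Walk v w)
    (h : a.edge ∉ p.edges) : v ∈ headSide a ↔ w ∈ headSide a :=
  have hvw : (T.deleteEdges {a.edge}).Reachable v w := (p.toDeleteEdge _ h).reachable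
  ⟨fun hv => hv.trans hvw, fun hw => hw.trans hvw.symm⟩

theorem mem_headSide_iff_of_adj {a : T.Dart} {v w : V} (h : T.Adj v w) (hne : a.edge ≠ s(v, w)) :
    v ∈ headSide a ↔ w ∈ headSide a :=
  mem_headSide_iff_of_edge_notMem h.toWalk (by simpa using hne)

theorem headSide_union_headSide_symm (hT : T.Connected) (a : T.Dart) :
    headSide a ∪ headSide a.symm = Set.univ := by
  set S := headSide a ∪ headSide a.symm
  by_contra h
  obtain ⟨v, hv⟩ := (Set.ne_univ_iff_exists_notMem S).1 h
  obtain ⟨p⟩ := hT a.snd v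
  obtain ⟨d, -, hd_fst, hd_snd⟩ := p.exists_boundary_dart S (.inl (snd_mem_headSide a)) hv
  have hne : d.edge ≠ a.edge := by
    rw [Ne, dart_edge_eq_iff]
    rintro (rfl | rfl)
    · exact hd_snd (.inl (snd_mem_headSide d))
    · exact hd_snd (.inr (snd_mem_headSide a.symm))
  refine hd_snd (hd_fst.imp (mem_headSide_iff_of_adj d.adj hne.symm).1
    (mem_headSide_iff_of_adj d.adj ?_).1)
  rwa [Dart.edge_symm, ne_comm]

theorem headSide_symm (hT : T.IsTree) (a : T.Dart) : headSide a.symm = (headSide a)ᶜ := by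
  refine Set.Subset.antisymm (fun v hv hv' => ?_) fun v =>
    ((headSide_union_headSide_symm hT.connected a).ge (Set.mem_univ v)).resolve_left
  have hbridge : ¬ (T.deleteEdges {a.edge}).Reachable a.fst a.snd :=
    isBridge_iff.1 (isAcyclic_iff_forall_isBridge.1 hT.isAcyclic a.edge_mem)
  rw [headSide, Dart.edge_symm] at hv
  exact hbridge (hv.trans hv'.symm)

theorem fst_notMem_headSide (hT : T.IsTree) (a : T.Dart) : a.fst ∉ headSide a := by
  rw [← Set.mem_compl_iff, ← headSide_symm hT]
  exact snd_mem_headSide a.symm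

theorem headSide_subset_or_subset_compl {a b : T.Dart} (h : b.fst ∉ headSide a) :
    headSide a ⊆ headSide b ∨ headSide a ⊆ (headSide b)ᶜ := by
  have hconst : ∀ v ∈ headSide a, (a.snd ∈ headSide b ↔ v ∈ headSide b) := by
    rintro v ⟨p⟩
    refine mem_headSide_iff_of_edge_notMem (p.mapLe (deleteEdges_le _)) fun hb => h ?_
    rw [Walk.edges_mapLe_eq_edges] at hb
    classical exact (p.takeUntil _ (p.fst_mem_support_of_mem_edges hb)).reachable
  by_cases ha : a.snd ∈ headSide b
  · exact .inl fun v hv => (hconst v hv).1 ha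
  · exact .inr fun v hv => mt (hconst v hv).2 ha

theorem headSide_noncrossing (hT : T.IsTree) (a b : T.Dart) :
    (headSide a ⊆ headSide b ∨ headSide a ⊆ (headSide b)ᶜ) ∨
      ((headSide a)ᶜ ⊆ headSide b ∨ (headSide a)ᶜ ⊆ (headSide b)ᶜ) := by
  by_cases h : b.fst ∈ headSide a
  · rw [← headSide_symm hT a]
    refine .inr (headSide_subset_or_subset_compl ?_)
    rwa [headSide_symm hT, Set.notMem_compl_iff]
  · exact .inl (headSide_subset_or_subset_compl h)

theorem mem_darts_iff_of_isPath (hT : T.IsTree) {v w : V} {p : T.Walk v w} (hp : p.IsPath)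
    (a : T.Dart) : a ∈ p.darts ↔ v ∉ headSide a ∧ w ∈ headSide a := by
  constructor
  · intro ha
    induction p with
    | nil => simp at ha
    | @cons u v w h p ih =>
      obtain ⟨hp', hu⟩ := (Walk.cons_isPath_iff h p).1 hp
      rcases List.mem_cons.1 (Walk.darts_cons h p ▸ ha) with rfl | ha
      · refine ⟨fst_notMem_headSide hT _, (mem_headSide_iff_of_edge_notMem p fun he => hu ?_).1
          (snd_mem_headSide _)⟩
        exact p.fst_mem_support_of_mem_edges he
      · obtain ⟨hv, hw⟩ := ih hp' ha
        refine ⟨mt (mem_headSide_iff_of_adj h fun he => hu ?_).1 hv, hw⟩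
        have hmem : a.edge ∈ p.edges := List.mem_map_of_mem ha
        exact p.fst_mem_support_of_mem_edges (he ▸ hmem)
  · rintro ⟨hv, hw⟩
    obtain ⟨d, hd, hd_fst, hd_snd⟩ := p.exists_boundary_dart (headSide a)ᶜ hv (by simpa using hw)
    have hedge : a.edge = d.edge := by
      by_contra hne
      exact hd_fst ((mem_headSide_iff_of_adj d.adj hne).2 (not_not.1 hd_snd))
    rcases (dart_edge_eq_iff a d).1 hedge with rfl | rfl
    · exact hd
    · exact absurd (snd_mem_headSide d.symm) hd_fst

open Classical in
theorem dist_eq_card_dart [Fintype V] [DecidableRel T.Adj] (hT : T.IsTree) (v w : V) :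
    T.dist v w = #{a : T.Dart | v ∉ headSide a ∧ w ∈ headSide a} := by
  obtain ⟨p, hp, hlen⟩ := hT.connected.exists_path_of_dist v w
  rw [← hlen, ← p.length_darts,
    ← List.toFinset_card_of_nodup (Walk.darts_nodup_of_support_nodup hp.support_nodup)]
  congr 1
  ext a
  simp [mem_darts_iff_of_isPath hT hp]

theorem dist_eq_two_of_adj_of_adj (hT : T.IsTree) {x y z : V} (hxy : T.Adj x y) (hzy : T.Adj z y)
    (hxz : x ≠ z) : T.dist x z = 2 := by
  have h := hT.dist_eq_dist_add_one_of_adj x hzy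
  rw [dist_eq_one_iff_adj.2 hxy] at h
  have := hT.connected.pos_dist_of_ne hxz
  omega

end Sides

section Separation

variable {V : Type*} {T : SimpleGraph V}

/-- The `0`-`1` indicator function of `headSide a`. -/
noncomputable def sideIndicator (a : T.Dart) : V → ℤ :=
  (headSide a).indicator 1

theorem sideIndicator_of_mem {a : T.Dart} {v : V} (h : v ∈ headSide a) :
    sideIndicator a v = 1 := Set.indicator_of_mem h _

theorem sideIndicator_of_notMem {a : T.Dart} {v : V} (h : v ∉ headSide a) :
    sideIndicator a v = 0 := Set.indicator_of_notMem h _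

theorem sideIndicator_nonneg (a : T.Dart) (v : V) : 0 ≤ sideIndicator a v :=
  Set.indicator_nonneg (fun _ _ => zero_le_one) v

theorem mem_headSide_of_sideIndicator_ne_zero {a : T.Dart} {v : V} (h : sideIndicator a v ≠ 0) :
    v ∈ headSide a := Set.mem_of_indicator_ne_zero h

theorem sideIndicator_congr {a : T.Dart} {v w : V} (h : v ∈ headSide a ↔ w ∈ headSide a) :
    sideIndicator a v = sideIndicator a w := by
  classical
  simp only [sideIndicator, Set.indicator_apply, h, Pi.one_apply]

theorem sideIndicator_symm (hT : T.IsTree) (a : T.Dart) (v : V) :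
    sideIndicator a.symm v = 1 - sideIndicator a v := by
  simp only [sideIndicator, headSide_symm hT, Set.indicator_compl, Pi.sub_apply, Pi.one_apply]

/-- The function of a pair of vertices which is `1` if both lie in `headSide a` and `0`
otherwise. -/
noncomputable def pairIndicator (a : T.Dart) (e : Sym2 V) : ℤ :=
  (e.map (sideIndicator a)).mul

theorem pairIndicator_mk (a : T.Dart) (w x : V) :
    pairIndicator a s(w, x) = sideIndicator a w * sideIndicator a x := rfl

theorem pairIndicator_nonneg (a : T.Dart) (e : Sym2 V) : 0 ≤ pairIndicator a e := by
  induction e with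
  | h w x => exact mul_nonneg (sideIndicator_nonneg a w) (sideIndicator_nonneg a x)

theorem pairIndicator_sub_pairIndicator [DecidableEq V] (hT : T.IsTree) (a : T.Dart) {x y z : V}
    (hxy : T.Adj x y) (hzy : T.Adj z y) (hxz : x ≠ z) :
    pairIndicator a s(x, z) - pairIndicator a s(x, y) =
      -if a = ⟨(z, y), hzy⟩ then 1 else 0 := by
  set b : T.Dart := ⟨(z, y), hzy⟩
  have hy : y ∈ headSide b := snd_mem_headSide b
  have hz : z ∉ headSide b := fst_notMem_headSide hT b
  have hx : x ∈ headSide b :=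
    (mem_headSide_iff_of_adj hxy (by simp [b, hxz.symm, hxy.ne.symm])).2 hy
  rw [pairIndicator_mk, pairIndicator_mk, ← mul_sub]
  by_cases hab : a = b
  · rw [hab, if_pos rfl, sideIndicator_of_mem hx, sideIndicator_of_mem hy,
      sideIndicator_of_notMem hz]
    norm_num
  · rw [if_neg hab, neg_zero, mul_eq_zero, sub_eq_zero]
    by_cases hab' : a = b.symm
    · left
      rw [hab', sideIndicator_symm hT, sideIndicator_of_mem hx, sub_self]
    · right
      exact sideIndicator_congr
        (mem_headSide_iff_of_adj hzy (mt (dart_edge_eq_iff a b).1 (by tauto)))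

/-- The distance in `T` between the two vertices of a pair. -/
noncomputable def pairDist (T : SimpleGraph V) : Sym2 V → ℤ :=
  Sym2.lift ⟨fun w x => (T.dist w x : ℤ), fun _ _ => congrArg Nat.cast T.dist_comm⟩

theorem pairDist_mk (w x : V) : pairDist T s(w, x) = T.dist w x := rfl

variable [Fintype V] [DecidableRel T.Adj]

theorem sum_dart_symm {M : Type*} [AddCommMonoid M] (f : T.Dart → M) :
    ∑ a : T.Dart, f a.symm = ∑ a, f a :=
  Equiv.sum_comp (Function.Involutive.toPerm _ Dart.symm_involutive) f

theorem two_mul_dist_eq_sum (hT : T.IsTree) (v w : V) :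
    2 * (T.dist v w : ℤ) = ∑ a : T.Dart, (sideIndicator a v - sideIndicator a w) ^ 2 := by
  classical
  nth_rw 1 [two_mul, T.dist_comm]
  rw [dist_eq_card_dart hT w v, dist_eq_card_dart hT v w, card_filter, card_filter, Nat.cast_sum,
    Nat.cast_sum, ← sum_add_distrib]
  refine sum_congr rfl fun a _ => ?_
  by_cases hv : v ∈ headSide a <;> by_cases hw : w ∈ headSide a <;>
    simp [sideIndicator, hv, hw]

variable (T) in
/-- The number of edges of a tree `T` that separate the pair `e` from the pair `f`: such an edge
has exactly one orientation with `e` on the head side and `f` on the tail side. -/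
noncomputable def separation (e f : Sym2 V) : ℤ :=
  ∑ a : T.Dart, pairIndicator a e * pairIndicator a.symm f

theorem separation_nonneg (e f : Sym2 V) : 0 ≤ separation T e f :=
  sum_nonneg fun a _ => mul_nonneg (pairIndicator_nonneg a e) (pairIndicator_nonneg a.symm f)

theorem separation_comm (e f : Sym2 V) : separation T e f = separation T f e := by
  rw [separation, ← sum_dart_symm]
  exact sum_congr rfl fun a _ => by rw [Dart.symm_symm, mul_comm]

theorem exists_dart_of_separation_ne_zero (hT : T.IsTree) {w x y z : V}
    (h : separation T s(w, x) s(y, z) ≠ 0) :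
    ∃ a : T.Dart, (w ∈ headSide a ∧ x ∈ headSide a) ∧ y ∉ headSide a ∧ z ∉ headSide a := by
  obtain ⟨a, -, ha⟩ := exists_ne_zero_of_sum_ne_zero h
  simp only [pairIndicator_mk, mul_ne_zero_iff] at ha
  obtain ⟨⟨hw, hx⟩, hy, hz⟩ := ha
  refine ⟨a, ⟨mem_headSide_of_sideIndicator_ne_zero hw, mem_headSide_of_sideIndicator_ne_zero hx⟩,
    ?_⟩
  simp only [← Set.mem_compl_iff, ← headSide_symm hT]
  exact ⟨mem_headSide_of_sideIndicator_ne_zero hy, mem_headSide_of_sideIndicator_ne_zero hz⟩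

theorem separation_eq_zero_or_separation_eq_zero (hT : T.IsTree) (w x y z : V) :
    separation T s(w, x) s(y, z) = 0 ∨ separation T s(w, y) s(x, z) = 0 := by
  by_contra! h
  obtain ⟨a, ⟨haw, hax⟩, hay, haz⟩ := exists_dart_of_separation_ne_zero hT h.1
  obtain ⟨b, ⟨hbw, hby⟩, hbx, hbz⟩ := exists_dart_of_separation_ne_zero hT h.2
  rcases headSide_noncrossing hT a b with (hab | hab) | (hab | hab)
  · exact hbx (hab hax)
  · exact hab haw hbw
  · exact hbz (hab haz)
  · exact hab hay hby

theorem two_mul_separation_eq_sum (hT : T.IsTree) (w x y z : V) :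
    2 * separation T s(w, x) s(y, z) = ∑ a : T.Dart,
      (sideIndicator a w * sideIndicator a x * ((1 - sideIndicator a y) * (1 - sideIndicator a z)) +
        (1 - sideIndicator a w) * (1 - sideIndicator a x) *
          (sideIndicator a y * sideIndicator a z)) := by
  nth_rw 1 [two_mul, separation_comm]
  simp only [separation, ← sum_add_distrib, pairIndicator_mk, sideIndicator_symm hT]
  exact sum_congr rfl fun a _ => by ring

theorem dist_add_dist_sub_dist_add_dist (hT : T.IsTree) (w x y z : V) :
    ((T.dist w y + T.dist x z : ℤ) - (T.dist w x + T.dist y z)) =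
      2 * separation T s(w, x) s(y, z) - 2 * separation T s(w, y) s(x, z) := by
  let S := ∑ a : T.Dart,
    (sideIndicator a w - sideIndicator a z) * (sideIndicator a x - sideIndicator a y)
  have hdist : 2 * (T.dist w y : ℤ) + 2 * T.dist x z - (2 * T.dist w x + 2 * T.dist y z) =
      2 * S := by
    simp only [two_mul_dist_eq_sum hT, S, ← sum_add_distrib, ← sum_sub_distrib, mul_sum]
    exact sum_congr rfl fun a _ => by ring
  have hsep : 2 * separation T s(w, x) s(y, z) - 2 * separation T s(w, y) s(x, z) = S := by
    simp only [two_mul_separation_eq_sum hT, S, ← sum_sub_distrib]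
    exact sum_congr rfl fun a _ => by ring
  linarith

theorem max4PCEntry_eq (hT : T.IsTree) (e f : Sym2 V) :
    (T.max4PCEntry e f : ℤ) = pairDist T e + pairDist T f + 2 * separation T e f := by
  induction e with | h w x
  induction f with | h y z
  have hwy := dist_add_dist_sub_dist_add_dist hT w x y z
  have hwz := dist_add_dist_sub_dist_add_dist hT w x z y
  have hxy := separation_eq_zero_or_separation_eq_zero hT w x y z
  have hxz := separation_eq_zero_or_separation_eq_zero hT w x z y
  have hyz := separation_eq_zero_or_separation_eq_zero hT w y z x
  rw [T.dist_comm (u := z)] at hwz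
  rw [Sym2.eq_swap (a := z) (b := y)] at hwz hxz
  rw [Sym2.eq_swap (a := z) (b := x), Sym2.eq_swap (a := y) (b := x)] at hyz
  have := separation_nonneg (T := T) s(w, x) s(y, z)
  have := separation_nonneg (T := T) s(w, y) s(x, z)
  have := separation_nonneg (T := T) s(w, z) s(x, y)
  simp only [max4PCEntry, Sym2.lift₂_mk, pairDist_mk]
  omega

end Separation

section InnerDarts

variable {V : Type*} [Fintype V] {T : SimpleGraph V} [DecidableRel T.Adj]

theorem headSide_eq_singleton_of_degree_eq_one {a : T.Dart} (ha : T.degree a.snd = 1) :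
    headSide a = {a.snd} := by
  refine Set.eq_singleton_iff_unique_mem.2 ⟨snd_mem_headSide a, ?_⟩
  rintro v ⟨p⟩
  cases p with
  | nil => rfl
  | @cons _ w _ h p =>
    rw [deleteEdges_adj] at h
    have hw : w = a.fst := (degree_eq_one_iff_existsUnique_adj.1 ha).unique h.1 a.adj.symm
    exact absurd (by rw [hw, Sym2.eq_swap]; rfl) h.2

theorem pairIndicator_eq_zero_of_degree_eq_one {a : T.Dart} (ha : T.degree a.snd = 1)
    {e : Sym2 V} (he : ¬ e.IsDiag) : pairIndicator a e = 0 := by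
  induction e with | h w x
  by_contra hne
  obtain ⟨hw, hx⟩ := mul_ne_zero_iff.1 hne
  replace hw := mem_headSide_of_sideIndicator_ne_zero hw
  replace hx := mem_headSide_of_sideIndicator_ne_zero hx
  rw [headSide_eq_singleton_of_degree_eq_one ha, Set.mem_singleton_iff] at hw hx
  exact he (hw.trans hx.symm)

theorem degree_ne_one_of_adj_of_degree_eq_one (hT : T.Connected) (hV : 3 ≤ Fintype.card V)
    {x y : V} (h : T.Adj x y) (hx : T.degree x = 1) : T.degree y ≠ 1 := by
  classical
  intro hy
  have huniv : (univ : Finset V) ⊆ {x, y} := fun v _ => by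
    rcases (headSide_union_headSide_symm hT ⟨(x, y), h⟩).ge (Set.mem_univ v) with hv | hv
    · rw [headSide_eq_singleton_of_degree_eq_one hy] at hv
      exact mem_insert_of_mem (mem_singleton.2 hv)
    · rw [headSide_eq_singleton_of_degree_eq_one hx] at hv
      exact mem_insert.2 (.inl hv)
  have := (card_le_card huniv).trans card_le_two
  rw [card_univ] at this
  omega

theorem exists_adj_ne_of_degree_ne_one {x y : V} (h : T.Adj x y) (hy : T.degree y ≠ 1) :
    ∃ z, T.Adj z y ∧ z ≠ x := by
  by_contra! hc
  exact hy (degree_eq_one_iff_existsUnique_adj.2 ⟨x, h.symm, fun z hz => hc z hz.symm⟩)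

variable (T) in
/-- The darts of the edges none of whose ends is a leaf. -/
abbrev InnerDart : Type _ := {a : T.Dart // T.degree a.fst ≠ 1 ∧ T.degree a.snd ≠ 1}

variable (T) in
/-- Reversal of inner darts. -/
def innerDartSymm : Equiv.Perm (InnerDart T) :=
  Function.Involutive.toPerm (fun a => ⟨a.1.symm, a.2.2, a.2.1⟩)
    fun a => Subtype.ext a.1.symm_symm

theorem coe_innerDartSymm (a : InnerDart T) : (innerDartSymm T a).1 = a.1.symm := rfl

theorem separation_eq_sum_innerDart {e f : Sym2 V} (he : ¬ e.IsDiag) (hf : ¬ f.IsDiag) :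
    separation T e f = ∑ a : InnerDart T, pairIndicator a.1 e * pairIndicator a.1.symm f := by
  rw [separation, ← sum_filter_of_ne
    (p := fun a : T.Dart => T.degree a.fst ≠ 1 ∧ T.degree a.snd ≠ 1)]
  · exact sum_subtype _ (by simp) _
  · refine fun a _ ha => ⟨fun hfst => ha ?_, fun hsnd => ha ?_⟩
    · rw [pairIndicator_eq_zero_of_degree_eq_one (a := a.symm) hfst hf, mul_zero]
    · rw [pairIndicator_eq_zero_of_degree_eq_one hsnd he, zero_mul]

theorem card_dart_degree_fst_eq_one :
    #{a : T.Dart | T.degree a.fst = 1} = #{v : V | T.degree v = 1} := by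
  classical
  rw [card_eq_sum_card_fiberwise (f := fun a : T.Dart => a.fst)
    (t := {v : V | T.degree v = 1}) (by intro a; simp), card_eq_sum_ones]
  refine sum_congr rfl fun v hv => ?_
  rw [mem_filter_univ] at hv
  calc #{a ∈ {a : T.Dart | T.degree a.fst = 1} | a.fst = v}
      = #{a : T.Dart | a.fst = v} := by
        rw [filter_filter]
        exact congrArg card (filter_congr fun a _ => and_iff_right_of_imp fun ha => ha ▸ hv)
    _ = 1 := (T.dart_fst_fiber_card_eq_degree v).trans hv

theorem card_dart_degree_snd_eq_one :
    #{a : T.Dart | T.degree a.snd = 1} = #{v : V | T.degree v = 1} := by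
  rw [← card_dart_degree_fst_eq_one, card_filter, card_filter, ← sum_dart_symm]
  rfl

theorem card_innerDart_add_card_leaves (hT : T.IsTree) (hV : 3 ≤ Fintype.card V) :
    Fintype.card (InnerDart T) + 2 * #{v : V | T.degree v = 1} + 2 = 2 * Fintype.card V := by
  classical
  have hdart : Fintype.card T.Dart + 2 = 2 * Fintype.card V := by
    rw [T.dart_card_eq_twice_card_edges, ← hT.card_edgeFinset, mul_add_one]
  have hdisj : Disjoint ({a : T.Dart | T.degree a.fst = 1} : Finset T.Dart)
      ({a : T.Dart | T.degree a.snd = 1} : Finset T.Dart) := by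
    rw [disjoint_filter]
    exact fun a _ => degree_ne_one_of_adj_of_degree_eq_one hT.connected hV a.adj
  have hsplit : Fintype.card (InnerDart T) + #(({a : T.Dart | T.degree a.fst = 1} : Finset T.Dart) ∪
      ({a : T.Dart | T.degree a.snd = 1} : Finset T.Dart)) = Fintype.card T.Dart := by
    rw [Fintype.card_subtype, ← filter_or, ← card_univ,
      ← card_filter_add_card_filter_not (s := univ)
        (p := fun a : T.Dart => T.degree a.fst ≠ 1 ∧ T.degree a.snd ≠ 1)]
    simp only [ne_eq, not_and_or, not_not]
  rw [card_union_of_disjoint hdisj, card_dart_degree_fst_eq_one, card_dart_degree_snd_eq_one]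
    at hsplit
  omega

end InnerDarts

section Factorization

variable {V : Type*} [Fintype V] {T : SimpleGraph V} [DecidableRel T.Adj]

variable (T) in
/-- The matrix whose rows are indexed by the pairs of distinct vertices, and whose columns are the
constant function `1`, the distance, and the functions `pairIndicator a` for the inner darts `a`. -/
noncomputable def pairMatrix : Matrix (VertexPair V) (Fin 2 ⊕ InnerDart T) ℤ :=
  Matrix.of fun e => Sum.elim ![1, pairDist T e.1] fun a => pairIndicator a.1 e.1

variable (T) in
/-- The involution of the columns of `pairMatrix` which exchanges the constant column with the
distance column and reverses the inner darts. -/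
def columnSwap : Equiv.Perm (Fin 2 ⊕ InnerDart T) :=
  Equiv.sumCongr (Equiv.swap 0 1) (innerDartSymm T)

theorem max4PC_eq_mul_diagonal_mul [DecidableEq V] (hT : T.IsTree) :
    T.max4PC = pairMatrix T *
      Matrix.diagonal (Sum.elim (fun _ => 1) fun _ => 2 : Fin 2 ⊕ InnerDart T → ℤ) *
      ((pairMatrix T).submatrix id (columnSwap T))ᵀ := by
  ext ⟨e, he⟩ ⟨f, hf⟩
  rw [Matrix.mul_apply, Fintype.sum_sum_type, Fin.sum_univ_two]
  simp only [SimpleGraph.max4PC, pairMatrix, columnSwap, Matrix.mul_diagonal,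
    Matrix.transpose_apply, Matrix.submatrix_apply, Matrix.of_apply, Equiv.sumCongr_apply,
    Sum.map_inl, Sum.map_inr, Sum.elim_inl, Sum.elim_inr, Equiv.swap_apply_left,
    Equiv.swap_apply_right, Matrix.cons_val_zero, Matrix.cons_val_one, id, coe_innerDartSymm,
    max4PCEntry_eq hT, separation_eq_sum_innerDart he hf, mul_sum]
  congr 1
  · ring
  · exact sum_congr rfl fun a _ => by ring

theorem row_mem_span_range_row (e : VertexPair V) :
    (pairMatrix T).row e ∈ Submodule.span ℤ (Set.range (pairMatrix T).row) :=
  Submodule.subset_span (Set.mem_range_self e)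

section RowSpace

variable [DecidableEq V]

theorem pairMatrix_row_sub_row (hT : T.IsTree) {x y z : V} (hxy : T.Adj x y) (hzy : T.Adj z y)
    (hxz : x ≠ z) :
    (pairMatrix T).row ⟨s(x, z), hxz⟩ - (pairMatrix T).row ⟨s(x, y), hxy.ne⟩ =
      Pi.single (Sum.inl 1) 1 -
        Sum.elim (fun _ => 0) fun a => if a.1 = ⟨(z, y), hzy⟩ then 1 else 0 := by
  ext k
  rcases k with k | a
  · fin_cases k
    · simp [pairMatrix]
    · simp [pairMatrix, pairDist_mk, dist_eq_two_of_adj_of_adj hT hxy hzy hxz,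
        dist_eq_one_iff_adj.2 hxy]
  · simpa [pairMatrix] using pairIndicator_sub_pairIndicator hT a.1 hxy hzy hxz

theorem single_dist_mem_span_range_row (hT : T.IsTree) (hV : 3 ≤ Fintype.card V) :
    (Pi.single (Sum.inl 1) 1 : Fin 2 ⊕ InnerDart T → ℤ) ∈
      Submodule.span ℤ (Set.range (pairMatrix T).row) := by
  have : Nontrivial V := Fintype.one_lt_card_iff_nontrivial.1 (by omega)
  obtain ⟨z, hz⟩ := hT.exists_vert_degree_one_of_nontrivial
  obtain ⟨y, hzy, -⟩ := degree_eq_one_iff_existsUnique_adj.1 hz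
  obtain ⟨x, hxy, hxz⟩ := exists_adj_ne_of_degree_ne_one hzy
    (degree_ne_one_of_adj_of_degree_eq_one hT.connected hV hzy hz)
  have hinner : ∀ a : InnerDart T, a.1 ≠ ⟨(z, y), hzy⟩ := fun a ha => a.2.1 (by rwa [ha])
  have hsub := pairMatrix_row_sub_row hT hxy hzy hxz
  simp only [hinner, if_false] at hsub
  rw [show (Sum.elim (fun _ => 0) fun _ => 0 : Fin 2 ⊕ InnerDart T → ℤ) = 0 from
    Sum.elim_zero_zero, sub_zero] at hsub
  exact hsub ▸ sub_mem (row_mem_span_range_row _) (row_mem_span_range_row _)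

theorem single_innerDart_mem_span_range_row (hT : T.IsTree) (hV : 3 ≤ Fintype.card V)
    (a : InnerDart T) :
    (Pi.single (Sum.inr a) 1 : Fin 2 ⊕ InnerDart T → ℤ) ∈
      Submodule.span ℤ (Set.range (pairMatrix T).row) := by
  obtain ⟨⟨⟨z, y⟩, hzy⟩, ha⟩ := a
  obtain ⟨x, hxy, hxz⟩ := exists_adj_ne_of_degree_ne_one hzy ha.2
  have hsingle : (Pi.single (Sum.inr ⟨⟨(z, y), hzy⟩, ha⟩) 1 : Fin 2 ⊕ InnerDart T → ℤ) =
      Sum.elim (fun _ => 0) fun b => if b.1 = ⟨(z, y), hzy⟩ then 1 else 0 := by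
    ext (k | b) <;> simp [Pi.single_apply, Subtype.ext_iff]
  have hsub := pairMatrix_row_sub_row hT hxy hzy hxz
  rw [← hsingle] at hsub
  rw [← sub_sub_cancel (Pi.single (Sum.inl 1) 1 : Fin 2 ⊕ InnerDart T → ℤ) (Pi.single _ 1), ← hsub]
  exact sub_mem (single_dist_mem_span_range_row hT hV)
    (sub_mem (row_mem_span_range_row _) (row_mem_span_range_row _))

theorem pairMatrix_row_eq_sum (e : VertexPair V) :
    (pairMatrix T).row e = Pi.single (Sum.inl 0) 1 + (pairDist T e.1 • Pi.single (Sum.inl 1) 1 +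
      ∑ a, pairIndicator a.1 e.1 • Pi.single (Sum.inr a) 1) := by
  rw [pi_eq_sum_univ' ((pairMatrix T).row e), Fintype.sum_sum_type, Fin.sum_univ_two, add_assoc]
  simp [pairMatrix]

end RowSpace

theorem span_range_row_pairMatrix (hT : T.IsTree) (hV : 3 ≤ Fintype.card V) :
    Submodule.span ℤ (Set.range (pairMatrix T).row) = ⊤ := by
  classical
  set R := Submodule.span ℤ (Set.range (pairMatrix T).row)
  have hdist : Pi.single (Sum.inl 1) 1 ∈ R := single_dist_mem_span_range_row hT hV
  have hinner : ∀ a, Pi.single (Sum.inr a) 1 ∈ R := single_innerDart_mem_span_range_row hT hV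
  have hone : Pi.single (Sum.inl 0) 1 ∈ R := by
    have : Nontrivial V := Fintype.one_lt_card_iff_nontrivial.1 (by omega)
    obtain ⟨x, y, hxy⟩ := exists_pair_ne V
    have hrow := row_mem_span_range_row (T := T) ⟨s(x, y), hxy⟩
    rw [pairMatrix_row_eq_sum] at hrow
    exact (R.add_mem_iff_left <| add_mem (R.smul_mem _ hdist)
      (sum_mem fun a _ => R.smul_mem _ (hinner a))).1 hrow
  refine eq_top_iff.2 fun v _ => ?_
  rw [pi_eq_sum_univ' v]
  refine sum_mem fun k _ => R.smul_mem _ ?_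
  rcases k with k | a
  · fin_cases k
    · exact hone
    · exact hdist
  · exact hinner a

theorem vecMul_pairMatrix_surjective [DecidableEq V] (hT : T.IsTree) (hV : 3 ≤ Fintype.card V) :
    Function.Surjective (pairMatrix T).vecMul := by
  rw [← Matrix.coe_vecMulLinear, ← LinearMap.range_eq_top, range_vecMulLinear,
    span_range_row_pairMatrix hT hV]

end Factorization

end TreeFourPoint

open TreeFourPoint

theorem mainTheorem3 {V : Type*} [Fintype V] [DecidableEq V] (T : SimpleGraph V)
    [DecidableRel T.Adj] (hT : T.IsTree) (n p : ℕ) (hn : Fintype.card V = n) (hn3 : 3 ≤ n)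
    (hp : (Finset.univ.filter fun v : V => T.degree v = 1).card = p) :
    T.max4PC.HasInvariantFactors
      (List.replicate 2 (1 : ℤ) ++ List.replicate (2 * (n - p - 1)) (2 : ℤ) ++
        List.replicate (n.choose 2 - 2 * (n - p)) (0 : ℤ)) := by
  have hcount := card_innerDart_add_card_leaves hT (hn.symm ▸ hn3)
  rw [hn, hp] at hcount
  have hinner : Fintype.card (InnerDart T) = 2 * (n - p - 1) := by omega
  have hcolumns : Fintype.card (Fin 2 ⊕ InnerDart T) = 2 * (n - p) := by
    rw [Fintype.card_sum, Fintype.card_fin]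
    omega
  have hpairs : Fintype.card (VertexPair V) = n.choose 2 := hn ▸ Sym2.card_subtype_not_diag
  have hsurj := vecMul_pairMatrix_surjective hT (hn.symm ▸ hn3)
  obtain ⟨e, he⟩ := exists_equiv_get_replicate_append (Fintype.card_fin 2) hinner (1 : ℤ) 2
  rw [max4PC_eq_mul_diagonal_mul hT, ← hpairs, ← hcolumns, ← funext he]
  refine hasInvariantFactors_mul_diagonal_mul hsurj (vecMul_submatrix_surjective hsurj _)
    (fun a ha => ?_) ?_ e
  · simp only [List.mem_append, List.mem_replicate] at ha
    omega
  · refine (List.isChain_replicate_of_rel _ dvd_rfl).append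
      (List.isChain_replicate_of_rel _ dvd_rfl) fun a ha b _ => ?_
    rw [List.eq_of_mem_replicate (List.mem_of_mem_getLast? ha)]
    exact one_dvd b
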